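/- **Theorem (pointfree Hausdorff–Alexandroff).** A *frame* is a complete lattice satisfying $(\bigvee A)\wedge b=\bigvee\{a\wedge b\mid a\in A\}$; a *frame homomorphism* is a map preserving finite meets (including the top $1$) and arbitrary joins (including the bottom $0$). A *cover* of a frame $L$ is a subset $A\subseteq L$ with $\bigvee A=1$; a cover $A$ *refines* a cover $B$ if every $a\in A$ lies below some $b\in B$. The frame $L$ is *compact* if every cover has a finite subcover. It is *metrizable* if it admits a countably generated uniformity, i.e. a nonempty family $\mathcal U$ of covers such that (i) any cover refined by a member of $\mathcal U$ is in $\mathcal U$; (ii) if $A,B\in\mathcal U$ then $\{a\wedge b\mid a\in A,\,b\in B\}\in\mathcal U$; (iii) for every $A\in\mathcal U$ there is $B\in\mathcal U$ such that $\{Bb\mid b\in B\}$ refines $A$, where $Bx=\bigvee\{b\in B\mid b\wedge x\neq 0\}$; (iv) $a=\bigvee\{x\mid Ax\le a\text{ for some }A\in\mathcal U\}$ for every $a\in L$; and (v) there is a countable $\mathcal B\subseteq\mathcal U$ such that every member of $\mathcal U$ is refined by a member of $\mathcal B$. Let $\mathcal L(\mathbb Z_2)$ be the frame of the $2$-adic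 integers, i.e. the frame generated by symbols $B_r(a)$, $a\in\mathbb Z$, $r\in R:=\{2^{-n+1}\mid n\in\mathbb N\}$ (with $0\in\mathbb N$), subject to the relations - $B_r(a)\wedge B_s(b)=0$ whenever $|a-b|_2\ge r$ and $s\le r$; - $1=\bigvee\{B_r(a)\mid a\in\mathbb Z,\ r\in R\}$; - $B_r(a)=\bigvee\{B_s(b)\mid b\in\mathbb Z,\ s\in R,\ |a-b|_2<r,\ s<r\}$. Then for every compact metrizable frame $L$ with $0\neq 1$ there is an injective frame homomorphism $\vartheta\colon L\to\mathcal L(\mathbb Z_2)$. -/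

import Mathlib

/-! ### Uniformities on frames, metrizable frames -/

/-- A cover of a frame: a subset whose join is the top element. -/
def IsFrameCover {L : Type*} [Order.Frame L] (A : Set L) : Prop :=
  sSup A = ⊤

/-- `A` refines `B`: every member of `A` lies below some member of `B`. -/
def CoverRefines {L : Type*} [Order.Frame L] (A B : Set L) : Prop :=
  ∀ a ∈ A, ∃ b ∈ B, a ≤ b

/-- The star `A · x = ⋁ {a ∈ A | a ∧ x ≠ 0}` of `x` with respect to `A`. -/
def coverStar {L : Type*} [Order.Frame L] (A : Set L) (x : L) : L :=
  sSup {a | a ∈ A ∧ a ⊓ x ≠ ⊥}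

/-- A (covering) uniformity on a frame `L`. -/
structure FrameUniformity (L : Type*) [Order.Frame L] where
  /-- The uniform covers. -/
  covers : Set (Set L)
  nonempty : covers.Nonempty
  isCover : ∀ A ∈ covers, IsFrameCover A
  of_refines : ∀ A ∈ covers, ∀ B : Set L, CoverRefines A B → B ∈ covers
  inter : ∀ A ∈ covers, ∀ B ∈ covers, {c | ∃ a ∈ A, ∃ b ∈ B, c = a ⊓ b} ∈ covers
  /-- Every uniform cover has a uniform star-refinement. -/
  star_refine : ∀ A ∈ covers, ∃ B ∈ covers, CoverRefines (coverStar B '' B) A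
  /-- Admissibility: every element is the join of the elements uniformly below it. -/
  admissible : ∀ a : L, a = sSup {x | ∃ A ∈ covers, coverStar A x ≤ a}

/-- A frame is metrizable if it admits a countably generated uniformity, that is, a uniformity
with a countable basis of uniform covers. -/
def IsMetrizableFrame (L : Type*) [Order.Frame L] : Prop :=
  ∃ U : FrameUniformity L, ∃ 𝓑 : Set (Set L), 𝓑.Countable ∧ 𝓑 ⊆ U.covers ∧
    ∀ A ∈ U.covers, ∃ B ∈ 𝓑, CoverRefines B A

/-- A frame is compact if every cover has a finite subcover. -/
def IsCompactFrame (L : Type*) [Order.Frame L] : Prop :=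
  ∀ A : Set L, IsFrameCover A → ∃ F ⊆ A, F.Finite ∧ IsFrameCover F

/-! ### Frames presented by generators and relations -/

/-- The free frame on a set `G` of generators: the down-sets of the free meet-semilattice
(with top) on `G`, which is the set of finite subsets of `G` ordered by reverse inclusion
(a finite subset stands for the formal meet of its elements). -/
abbrev FreeFrame (G : Type*) : Type _ := LowerSet (Finset G)ᵒᵈ

/-- The canonical inclusion of the generators in the free frame. -/
def FreeFrame.of {G : Type*} (g : G) : FreeFrame G :=
  LowerSet.Iic (OrderDual.toDual {g})

/-- The quotient of a frame `F` by a relation `R`, that is, the largest quotient frame of `F` in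
which `u` and `v` become equal whenever `R u v`. It is realized, as usual, as the sublocale
of the `R`-saturated elements of `F`. -/
def saturatedSublocale {F : Type*} [Order.Frame F] (R : F → F → Prop) : Sublocale F where
  carrier := {x | ∀ u v, R u v → ∀ w, u ⊓ w ≤ x ↔ v ⊓ w ≤ x}
  sInf_mem' := by
    intro s hs u v huv w
    simp only [le_sInf_iff]
    exact ⟨fun h b hb => (hs hb u v huv w).1 (h b hb),
      fun h b hb => (hs hb u v huv w).2 (h b hb)⟩
  himp_mem' := by
    intro a b hb u v huv w
    simp only [le_himp_iff, inf_assoc]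
    exact hb u v huv (w ⊓ a)

/-- The frame presented by the set `G` of generators subject to the relations `u = v` for
all `u`, `v` in the free frame with `R u v`. -/
abbrev PresentedFrame (G : Type*) (R : FreeFrame G → FreeFrame G → Prop) : Type _ :=
  saturatedSublocale R

/-! ### The frame of the `p`-adic integers -/

/-- The radius `p ^ (-n + 1)`. -/
def padicRadius (p n : ℕ) : ℚ := (p : ℚ) ^ (-(n : ℤ) + 1)

/-- The formal open ball `B_r(a)` with centre `a : ℤ` and radius `r = p ^ (-n + 1)`, as an element
of the free frame on all such balls; the pair `(a, n)` stands for this ball. -/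
def padicBall (a : ℤ) (n : ℕ) : FreeFrame (ℤ × ℕ) := FreeFrame.of (a, n)

/-- The defining relations between the formal balls. -/
inductive PadicRel (p : ℕ) : FreeFrame (ℤ × ℕ) → FreeFrame (ℤ × ℕ) → Prop
  /-- `B_r(a) ∧ B_s(b) = 0` whenever `|a - b|_p ≥ r` and `s ≤ r`. -/
  | disjoint (a b : ℤ) (n m : ℕ) (hab : padicRadius p n ≤ padicNorm p ((a - b : ℤ) : ℚ))
      (hsr : padicRadius p m ≤ padicRadius p n) :
      PadicRel p (padicBall a n ⊓ padicBall b m) ⊥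
  /-- `1 = ⋁ B_r(a)`, the join being over all balls. -/
  | cover : PadicRel p ⊤ (sSup {x | ∃ (a : ℤ) (n : ℕ), x = padicBall a n})
  /-- `B_r(a) = ⋁ {B_s(b) | |a - b|_p < r, s < r}`. -/
  | ball (a : ℤ) (n : ℕ) :
      PadicRel p (padicBall a n)
        (sSup {x | ∃ (b : ℤ) (m : ℕ), padicNorm p ((a - b : ℤ) : ℚ) < padicRadius p n ∧
          padicRadius p m < padicRadius p n ∧ x = padicBall b m})

/-- The frame `L(ℤ_p)` of the `p`-adic integers (for a prime number `p`), presented by the balls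
`B_r(a)` with `a ∈ ℤ` and `r ∈ {p ^ (-n + 1) | n ∈ ℕ}` and the relations `PadicRel p`. -/
abbrev PadicIntFrame (p : ℕ) : Type := PresentedFrame (ℤ × ℕ) (PadicRel p)

/-! The proof passes through points. Admissibility and compactness give `L` enough points
(`IsCompactFrame.exists_point`), so `L` embeds in the opens of its point space. That space is
nonempty, compact, regular, T0 and second countable, hence metrizable, and the classical
Hausdorff–Alexandroff theorem makes it a continuous image of Cantor space. Binary digits map `ℤ_[2]`
continuously onto Cantor space, and preimage along a surjection is injective on opens.

It remains to embed `Opens ℤ_[p]` in the presented frame, sending `U` to the largest formal element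
realized inside `U`. The hard point is preservation of joins (`formalBallsWithin_sUnion_le`), where
compactness of `ℤ_[p]` replaces an infinite cover by balls of one small radius. -/

open Set Filter Topology TopologicalSpace OrderDual

/-! ### The frame of opens of `ℤ_p` embeds in the frame presented by formal balls -/

section Balls

variable (p : ℕ) [Fact p.Prime]

/-- The intersection of the open balls of `ℤ_p` named by a finite set of formal balls. -/
def padicBallInter (F : (Finset (ℤ × ℕ))ᵒᵈ) : Set ℤ_[p] :=
  ⋂ g ∈ ofDual F, Metric.ball (g.1 : ℤ_[p]) (padicRadius p g.2 : ℝ)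

/-- The subset of `ℤ_p` named by an element of the free frame on the formal balls. -/
def padicRealize (u : FreeFrame (ℤ × ℕ)) : Set ℤ_[p] :=
  {x | ∃ F ∈ u, x ∈ padicBallInter p F}

/-- The largest element of the free frame on the formal balls whose realization lies in `U`. -/
def formalBallsWithin (U : Set ℤ_[p]) : FreeFrame (ℤ × ℕ) where
  carrier := {F | padicBallInter p F ⊆ U}
  lower' _ _ hFG hF := (biInter_subset_biInter_left hFG).trans hF

variable {p}

theorem mem_padicBallInter {F : (Finset (ℤ × ℕ))ᵒᵈ} {x : ℤ_[p]} :
    x ∈ padicBallInter p F ↔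
      ∀ g ∈ ofDual F, x ∈ Metric.ball (g.1 : ℤ_[p]) (padicRadius p g.2 : ℝ) := by
  simp [padicBallInter]

theorem mem_formalBallsWithin {U : Set ℤ_[p]} {F : (Finset (ℤ × ℕ))ᵒᵈ} :
    F ∈ formalBallsWithin p U ↔ padicBallInter p F ⊆ U := Iff.rfl

/-- This adjunction turns inequalities in the free frame into inclusions of subsets of `ℤ_[p]`. -/
theorem padicRealize_subset_iff {u : FreeFrame (ℤ × ℕ)} {U : Set ℤ_[p]} :
    padicRealize p u ⊆ U ↔ u ≤ formalBallsWithin p U :=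
  ⟨fun h F hF _ hx => h ⟨F, hF, hx⟩, fun h _ ⟨_, hF, hx⟩ => h hF hx⟩

theorem padicRealize_inf (u v : FreeFrame (ℤ × ℕ)) :
    padicRealize p (u ⊓ v) = padicRealize p u ∩ padicRealize p v := by
  ext x
  constructor
  · rintro ⟨F, ⟨hu, hv⟩, hx⟩
    exact ⟨⟨F, hu, hx⟩, ⟨F, hv, hx⟩⟩
  · rintro ⟨⟨F, hF, hFx⟩, ⟨G, hG, hGx⟩⟩
    refine ⟨toDual (ofDual F ∪ ofDual G),
      ⟨u.lower (show ofDual F ⊆ ofDual F ∪ ofDual G from Finset.subset_union_left) hF,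
        v.lower (show ofDual G ⊆ ofDual F ∪ ofDual G from Finset.subset_union_right) hG⟩, ?_⟩
    rw [mem_padicBallInter] at hFx hGx ⊢
    intro g hg
    rcases Finset.mem_union.1 hg with h | h
    exacts [hFx g h, hGx g h]

theorem mem_padicRealize_sSup {S : Set (FreeFrame (ℤ × ℕ))} {x : ℤ_[p]} :
    x ∈ padicRealize p (sSup S) ↔ ∃ u ∈ S, x ∈ padicRealize p u := by
  simp only [padicRealize, LowerSet.mem_sSup_iff, mem_ofPred_eq]
  constructor
  · rintro ⟨F, ⟨u, hu, hF⟩, hx⟩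
    exact ⟨u, hu, F, hF, hx⟩
  · rintro ⟨u, hu, F, hF, hx⟩
    exact ⟨F, ⟨u, hu, hF⟩, hx⟩

theorem padicRealize_bot : padicRealize p ⊥ = ∅ := by
  ext x
  simp [padicRealize]

theorem padicRealize_top : padicRealize p ⊤ = univ := by
  ext x
  simp only [padicRealize, LowerSet.mem_top, true_and, mem_ofPred_eq, mem_univ, iff_true]
  exact ⟨toDual ∅, mem_padicBallInter.2 fun g hg => absurd hg (Finset.notMem_empty g)⟩

theorem padicBallInter_singleton (g : ℤ × ℕ) :
    padicBallInter p (toDual {g}) = Metric.ball (g.1 : ℤ_[p]) (padicRadius p g.2 : ℝ) := by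
  simp [padicBallInter]

theorem padicRealize_padicBall (a : ℤ) (n : ℕ) :
    padicRealize p (padicBall a n) = Metric.ball (a : ℤ_[p]) (padicRadius p n : ℝ) := by
  refine Subset.antisymm (padicRealize_subset_iff.2 ?_) fun x hx =>
    ⟨toDual {(a, n)}, LowerSet.mem_Iic_iff.2 le_rfl, by rwa [padicBallInter_singleton]⟩
  intro F hF
  rw [← padicBallInter_singleton (a, n)]
  exact biInter_subset_biInter_left hF

theorem dist_intCast_padicInt (a b : ℤ) :
    dist (a : ℤ_[p]) (b : ℤ_[p]) = (padicNorm p ((a - b : ℤ) : ℚ) : ℝ) := by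
  rw [dist_eq_norm, ← Int.cast_sub, PadicInt.norm_intCast_eq_padic_norm,
    ← Padic.eq_padicNorm]
  norm_cast

variable (p) in
theorem padicRadius_pos (n : ℕ) : 0 < padicRadius p n :=
  zpow_pos (by exact_mod_cast (Fact.out : p.Prime).pos) _

variable (p) in
theorem padicRadius_strictAnti : StrictAnti (padicRadius p) := fun m n h =>
  zpow_lt_zpow_right₀ (by exact_mod_cast (Fact.out : p.Prime).one_lt) (by lia)

variable (p) in
theorem exists_padicRadius_lt {ε : ℝ} (hε : 0 < ε) : ∃ n, (padicRadius p n : ℝ) < ε := by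
  obtain ⟨k, hk⟩ := PadicInt.exists_pow_neg_lt p hε
  -- The shift by one absorbs the `+ 1` in the exponent of `padicRadius`.
  refine ⟨k + 1, ?_⟩
  have : (padicRadius p (k + 1) : ℝ) = (p : ℝ) ^ (-(k : ℤ)) := by
    simp [padicRadius]
  rwa [this]

theorem exists_intCast_dist_lt (x : ℤ_[p]) {ε : ℝ} (hε : 0 < ε) :
    ∃ b : ℤ, dist x (b : ℤ_[p]) < ε :=
  PadicInt.denseRange_intCast.exists_dist_lt x hε

theorem padicRealize_eq_of_padicRel {u v : FreeFrame (ℤ × ℕ)} (h : PadicRel p u v) :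
    padicRealize p u = padicRealize p v := by
  cases h with
  | disjoint a b n m hab hsr =>
    rw [padicRealize_inf, padicRealize_padicBall, padicRealize_padicBall, padicRealize_bot,
      eq_empty_iff_forall_notMem]
    rintro x ⟨hx, hy⟩
    have hd := dist_triangle_max (a : ℤ_[p]) x (b : ℤ_[p])
    rw [dist_intCast_padicInt] at hd
    rw [Metric.mem_ball'] at hx
    rw [Metric.mem_ball] at hy
    have h1 : (padicRadius p m : ℝ) ≤ padicRadius p n := by exact_mod_cast hsr
    have h2 : (padicRadius p n : ℝ) ≤ padicNorm p ((a - b : ℤ) : ℚ) := by exact_mod_cast hab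
    exact absurd (hd.trans_lt (max_lt hx (hy.trans_le h1))) (not_lt.2 h2)
  | cover =>
    rw [padicRealize_top]
    refine (eq_univ_of_forall fun x => mem_padicRealize_sSup.2 ?_).symm
    obtain ⟨b, hb⟩ := exists_intCast_dist_lt x
      (show (0 : ℝ) < padicRadius p 0 by exact_mod_cast padicRadius_pos p 0)
    exact ⟨_, ⟨b, 0, rfl⟩, by rwa [padicRealize_padicBall]⟩
  | ball a n =>
    ext x
    rw [mem_padicRealize_sSup, padicRealize_padicBall]
    constructor
    · intro hx
      have hr : (padicRadius p (n + 1) : ℝ) < padicRadius p n := by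
        exact_mod_cast padicRadius_strictAnti p n.lt_succ_self
      obtain ⟨b, hb⟩ := exists_intCast_dist_lt x
        (show (0 : ℝ) < padicRadius p (n + 1) by exact_mod_cast padicRadius_pos p _)
      refine ⟨_, ⟨b, n + 1, ?_, padicRadius_strictAnti p n.lt_succ_self, rfl⟩,
        by rwa [padicRealize_padicBall]⟩
      have hd := (dist_triangle_max (a : ℤ_[p]) x (b : ℤ_[p])).trans_lt
        (max_lt (Metric.mem_ball'.1 hx) (hb.trans hr))
      rw [dist_intCast_padicInt] at hd
      exact_mod_cast hd
    · rintro ⟨_, ⟨b, m, hab, hmn, rfl⟩, hx⟩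
      rw [padicRealize_padicBall] at hx
      have h1 : (padicRadius p m : ℝ) < padicRadius p n := by exact_mod_cast hmn
      have h2 : dist (a : ℤ_[p]) (b : ℤ_[p]) < padicRadius p n := by
        rw [dist_intCast_padicInt]
        exact_mod_cast hab
      exact Metric.mem_ball'.2 <|
        (dist_triangle_max (a : ℤ_[p]) (b : ℤ_[p]) x).trans_lt
          (max_lt h2 ((Metric.mem_ball'.1 hx).trans h1))

theorem formalBallsWithin_mem (U : Set ℤ_[p]) :
    formalBallsWithin p U ∈ saturatedSublocale (PadicRel p) := by
  intro u v huv w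
  rw [← padicRealize_subset_iff, ← padicRealize_subset_iff, padicRealize_inf, padicRealize_inf,
    padicRealize_eq_of_padicRel huv]

theorem isClosed_padicBallInter (F : (Finset (ℤ × ℕ))ᵒᵈ) : IsClosed (padicBallInter p F) :=
  isClosed_biInter fun _ _ => IsUltrametricDist.isClosed_ball _ _

/-- A finite meet `F` of balls is realized by a compact set, so a Lebesgue number bounds the radii
that matter. The covering and ball relations cut `F` into pieces of such radii, each of which lies
in `X`. -/
theorem formalBallsWithin_sUnion_le {X : FreeFrame (ℤ × ℕ)}
    (hX : X ∈ saturatedSublocale (PadicRel p)) {S : Set (Set ℤ_[p])} (hS : ∀ U ∈ S, IsOpen U)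
    (hle : ∀ U ∈ S, formalBallsWithin p U ≤ X) : formalBallsWithin p (⋃₀ S) ≤ X := by
  intro F hF
  obtain ⟨δ, hδ, hleb⟩ := lebesgue_number_lemma_of_metric_sUnion
    (isClosed_padicBallInter F).isCompact hS hF
  obtain ⟨n, hn⟩ := exists_padicRadius_lt p hδ
  -- From level `N` on, balls are smaller than the Lebesgue number and no larger than any ball in
  -- `F`.
  set N := max n ((ofDual F).sup Prod.snd)
  have hN : ∀ g ∈ ofDual F, g.2 ≤ N := fun g hg =>
    (Finset.le_sup (f := Prod.snd) hg).trans (le_max_right _ _)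
  -- `k` bounds the number of subdivisions needed to reach level `N`.
  have hball : ∀ (k : ℕ) (b : ℤ) (m : ℕ), N ≤ m + k → padicBall b m ⊓ LowerSet.Iic F ≤ X := by
    intro k
    induction k with
    | zero =>
      intro b m hm
      rw [add_zero] at hm
      by_cases hb : (b : ℤ_[p]) ∈ padicBallInter p F
      · obtain ⟨U, hU, hbU⟩ := hleb b hb
        refine inf_le_left.trans (le_trans ?_ (hle U hU))
        rw [← padicRealize_subset_iff, padicRealize_padicBall]
        refine (Metric.ball_subset_ball ?_).trans hbU
        have : (padicRadius p m : ℝ) ≤ padicRadius p n := by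
          exact_mod_cast (padicRadius_strictAnti p).antitone ((le_max_left _ _).trans hm)
        exact this.trans hn.le
      -- The centre misses some ball of `F`, so the disjointness relation kills the meet with that
      -- ball.
      · rw [mem_padicBallInter] at hb
        push Not at hb
        obtain ⟨⟨c, l⟩, hg, hbc⟩ := hb
        rw [Metric.mem_ball', dist_intCast_padicInt, not_lt] at hbc
        have := (hX _ _ (PadicRel.disjoint c b l m (by exact_mod_cast hbc)
          ((padicRadius_strictAnti p).antitone ((hN _ hg).trans hm))) ⊤).2 (by simp)
        rw [inf_top_eq] at this
        refine le_trans (le_inf (inf_le_right.trans ?_) inf_le_left) this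
        exact LowerSet.Iic_le.2 (show _ ≤ _ from Finset.singleton_subset_iff.2 hg)
    | succ k ih =>
      intro b m hm
      rw [hX _ _ (PadicRel.ball b m), sSup_inf_eq]
      refine iSup₂_le ?_
      rintro _ ⟨c, l, -, hl, rfl⟩
      have := (padicRadius_strictAnti p).lt_iff_gt.1 hl
      exact ih c l (by lia)
  have hFX : LowerSet.Iic F ≤ X := by
    rw [← top_inf_eq (LowerSet.Iic F), hX _ _ PadicRel.cover, sSup_inf_eq]
    refine iSup₂_le ?_
    rintro _ ⟨b, m, rfl⟩
    exact hball N b m (Nat.le_add_left _ _)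
  exact hFX (LowerSet.mem_Iic_iff.2 le_rfl)

variable (p) in
/-- The frame homomorphism from the opens of `ℤ_p` to the frame of the `p`-adic integers. -/
def opensToPadicIntFrame : FrameHom (Opens ℤ_[p]) (PadicIntFrame p) where
  toFun U := ⟨formalBallsWithin p U, formalBallsWithin_mem _⟩
  map_inf' U V := Subtype.ext <| LowerSet.ext <| by
    ext F
    exact subset_inter_iff
  map_top' := Subtype.ext <| LowerSet.ext <| by
    ext F
    exact iff_of_true (subset_univ _) trivial
  map_sSup' S := by
    apply le_antisymm
    · set T : PadicIntFrame p := sSup _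
      have := formalBallsWithin_sUnion_le (X := T.1) T.2 (S := (↑) '' S)
        (by rintro _ ⟨U, -, rfl⟩; exact U.isOpen)
        (by
          rintro _ ⟨U, hU, rfl⟩
          exact le_sSup (a := (⟨formalBallsWithin p U, formalBallsWithin_mem _⟩ :
            PadicIntFrame p)) (mem_image_of_mem _ hU))
      rw [sUnion_image, ← Opens.coe_sSup] at this
      exact this
    · refine sSup_le ?_
      rintro _ ⟨U, hU, rfl⟩
      exact fun F hF => Subset.trans (mem_formalBallsWithin.1 hF)
        (SetLike.coe_subset_coe.2 (le_sSup hU))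

theorem opensToPadicIntFrame_injective : Function.Injective (opensToPadicIntFrame p) := by
  have key : ∀ U V : Opens ℤ_[p], opensToPadicIntFrame p U = opensToPadicIntFrame p V →
      U ≤ V := by
    intro U V h x hx
    obtain ⟨ε, hε, hball⟩ := Metric.isOpen_iff.1 U.isOpen x hx
    obtain ⟨n, hn⟩ := exists_padicRadius_lt p hε
    obtain ⟨b, hb⟩ := exists_intCast_dist_lt x
      (show (0 : ℝ) < padicRadius p n by exact_mod_cast padicRadius_pos p n)
    have hU : toDual {(b, n)} ∈ formalBallsWithin p U := by
      rw [mem_formalBallsWithin, padicBallInter_singleton]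
      refine subset_trans (fun y hy => ?_) hball
      exact ((dist_triangle_max y (b : ℤ_[p]) x).trans_lt
        (max_lt hy (by rwa [dist_comm]))).trans hn
    have hUV : formalBallsWithin p U = formalBallsWithin p V := congrArg Subtype.val h
    rw [hUV, mem_formalBallsWithin, padicBallInter_singleton] at hU
    exact hU hb
  exact fun U V h => le_antisymm (key U V h) (key V U h.symm)

end Balls


/-! ### The space of points of a compact metrizable frame -/

section Points

variable {L : Type*} [Order.Frame L]

theorem IsCompactFrame.isCompactElement_top (h : IsCompactFrame L) :
    IsCompactElement (⊤ : L) := by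
  rw [CompleteLattice.isCompactElement_iff_exists_le_sSup_of_le_sSup]
  intro A hA
  obtain ⟨F, hFA, hF, hcov⟩ := h A (top_le_iff.1 hA)
  refine ⟨hF.toFinset, by simpa using hFA, ?_⟩
  rw [Finset.sup_id_eq_sSup, hF.coe_toFinset]
  exact hcov.ge

/-- The point of a frame given by a maximal element. -/
def IsCoatom.toPoint {c : L} (hc : IsCoatom c) : Locale.PT L where
  toFun u := ¬ u ≤ c
  map_inf' u v := by
    refine propext ⟨fun h => ⟨fun hu => h (inf_le_left.trans hu),
      fun hv => h (inf_le_right.trans hv)⟩, ?_⟩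
    rintro ⟨hu, hv⟩ h
    have h1 : c ⊔ u = ⊤ := hc.2 _ (left_lt_sup.2 hu)
    have h2 : c ⊔ v = ⊤ := hc.2 _ (left_lt_sup.2 hv)
    apply hc.1
    -- Distributivity makes a maximal element prime: `c = c ⊔ (u ⊓ v) = (c ⊔ u) ⊓ (c ⊔ v) = ⊤`.
    rw [← sup_eq_left.2 h, sup_inf_left, h1, h2, top_inf_eq]
  map_top' := by simpa using hc.1
  map_sSup' S := by simp [Prop.exists_iff]

theorem Locale.PT.not_bot (x : Locale.PT L) : ¬ x ⊥ := by simp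

theorem Locale.PT.inf_iff (x : Locale.PT L) (a b : L) : x (a ⊓ b) ↔ x a ∧ x b := by simp

theorem Locale.PT.sSup_iff (x : Locale.PT L) (S : Set L) : x (sSup S) ↔ ∃ a ∈ S, x a := by
  simp [Prop.exists_iff]

theorem Locale.PT.mono (x : Locale.PT L) {a b : L} (h : a ≤ b) : x a → x b :=
  OrderHomClass.mono x h

/-- If `x` is uniformly below `a`, then `x` is rather below `a`. -/
theorem exists_disjoint_sup_eq_top {A : Set L} (hA : IsFrameCover A) {x a : L}
    (h : coverStar A x ≤ a) : ∃ y, x ⊓ y = ⊥ ∧ y ⊔ a = ⊤ := by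
  refine ⟨sSup {b | b ∈ A ∧ b ⊓ x = ⊥}, ?_, ?_⟩
  · rw [inf_sSup_eq]
    simp only [iSup_eq_bot]
    rintro b ⟨-, hb⟩
    rwa [inf_comm]
  · refine top_le_iff.1 (hA.symm.le.trans ?_)
    refine sSup_le fun b hb => ?_
    by_cases hbx : b ⊓ x = ⊥
    · exact le_sup_of_le_left (le_sSup ⟨hb, hbx⟩)
    · exact le_sup_of_le_right (le_trans (b := coverStar A x) (le_sSup ⟨hb, hbx⟩) h)

theorem FrameUniformity.exists_of_not_le (U : FrameUniformity L) {a b : L} (h : ¬ a ≤ b) :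
    ∃ x, ∃ A ∈ U.covers, coverStar A x ≤ a ∧ ¬ x ≤ b := by
  contrapose! h
  rw [U.admissible a]
  exact sSup_le fun x ⟨A, hA, hx⟩ => h x A hA hx

theorem FrameUniformity.exists_of_point (U : FrameUniformity L) (p : Locale.PT L) {a : L}
    (h : p a) : ∃ x, ∃ A ∈ U.covers, coverStar A x ≤ a ∧ p x := by
  rw [U.admissible a, p.sSup_iff] at h
  obtain ⟨x, ⟨A, hA, hx⟩, hp⟩ := h
  exact ⟨x, A, hA, hx, hp⟩

theorem coverStar_le_of_mem {A : Set L} {x b : L} (hb : b ∈ A) {p : Locale.PT L} (hpb : p b)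
    (hpx : p x) : b ≤ coverStar A x := by
  refine le_sSup ⟨hb, fun h => p.not_bot ?_⟩
  rw [← h, p.inf_iff]
  exact ⟨hpb, hpx⟩

/-- Compact uniformizable frames have enough points. -/
theorem IsCompactFrame.exists_point (h : IsCompactFrame L) (U : FrameUniformity L) {a b : L}
    (hab : ¬ a ≤ b) : ∃ p : Locale.PT L, p a ∧ ¬ p b := by
  obtain ⟨x, A, hA, hxa, hxb⟩ := U.exists_of_not_le hab
  obtain ⟨y, hxy, hya⟩ := exists_disjoint_sup_eq_top (U.isCover A hA) hxa
  have : IsCoatomic L := CompleteLattice.coatomic_of_top_compact h.isCompactElement_top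
  -- If `b ⊔ y = ⊤`, then `x = x ⊓ (b ⊔ y) = x ⊓ b`, contradicting `¬ x ≤ b`. Otherwise a coatom
  -- above `b ⊔ y` cannot lie above `a`, because `y ⊔ a = ⊤`.
  obtain htop | ⟨c, hc, hbc⟩ := eq_top_or_exists_le_coatom (b ⊔ y)
  · refine absurd ?_ hxb
    rw [← inf_eq_left, ← sup_bot_eq (x ⊓ b), ← hxy, ← inf_sup_left, htop, inf_top_eq]
  · refine ⟨hc.toPoint, fun hac => hc.1 ?_, fun hb => hb (le_sup_left.trans hbc)⟩
    exact top_le_iff.1 (hya ▸ sup_le (le_sup_right.trans hbc) hac)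

theorem Locale.PT.isOpen_ofPred (u : L) : IsOpen {x : Locale.PT L | x u} := ⟨u, rfl⟩

theorem IsCompactFrame.compactSpace_points (h : IsCompactFrame L) (U : FrameUniformity L) :
    CompactSpace (Locale.PT L) := by
  refine ⟨isCompact_of_finite_subcover fun {ι} V hV hcov => ?_⟩
  choose u hu using hV
  have htop : ⊤ ≤ sSup (range u) := by
    by_contra hne
    obtain ⟨p, -, hp⟩ := h.exists_point U hne
    obtain ⟨i, hi⟩ := mem_iUnion.1 (hcov (mem_univ p))
    rw [← hu i] at hi
    exact hp (p.mono (le_sSup (mem_range_self i)) hi)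
  obtain ⟨t, ht⟩ := CompleteLattice.isCompactElement_iff_exists_le_iSup_of_le_iSup _ |>.1
    h.isCompactElement_top ι u htop
  refine ⟨t, fun p _ => ?_⟩
  have hp : p (t.sup u) := p.mono ht (by simp)
  rw [Finset.sup_eq_sSup_image, p.sSup_iff] at hp
  obtain ⟨_, ⟨i, hi, rfl⟩, hpi⟩ := hp
  refine mem_iUnion₂.2 ⟨i, hi, ?_⟩
  rw [← hu i]
  exact hpi

instance Locale.PT.instT0Space : T0Space (Locale.PT L) := by
  refine ⟨fun p q h => FrameHom.ext fun a => propext ?_⟩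
  exact h.mem_open_iff (Locale.PT.isOpen_ofPred a)

/-- The closed complement of the open set of `y` sits between the open sets of `x` and `a`, since `x
⊓ y = ⊥` and `y ⊔ a = ⊤`. -/
theorem FrameUniformity.regularSpace_points (U : FrameUniformity L) :
    RegularSpace (Locale.PT L) := by
  refine .of_exists_mem_nhds_isClosed_subset fun p s hs => ?_
  obtain ⟨_, hts, ⟨a, rfl⟩, hpa⟩ := mem_nhds_iff.1 hs
  obtain ⟨x, A, hA, hxa, hpx⟩ := U.exists_of_point p hpa
  obtain ⟨y, hxy, hya⟩ := exists_disjoint_sup_eq_top (U.isCover A hA) hxa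
  refine ⟨{q | q y}ᶜ, mem_of_superset ((Locale.PT.isOpen_ofPred x).mem_nhds hpx) ?_,
    (Locale.PT.isOpen_ofPred y).isClosed_compl, subset_trans ?_ hts⟩
  · intro q hqx hqy
    apply q.not_bot
    rw [← hxy, q.inf_iff]
    exact ⟨hqx, hqy⟩
  · intro q hqy
    have : q (sSup {y, a}) := by rw [sSup_pair, hya]; simp
    obtain ⟨b, rfl | rfl, hb⟩ := (q.sSup_iff _).1 this
    exacts [absurd hb hqy, hb]

/-- Finite subcovers of the countably many basic covers together supply a countable base. -/
theorem IsCompactFrame.secondCountableTopology_points (h : IsCompactFrame L)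
    (hL : IsMetrizableFrame L) : SecondCountableTopology (Locale.PT L) := by
  obtain ⟨U, 𝓑, hcount, hsub, hbasis⟩ := hL
  choose! F hF hfin hcov using fun B hB => h B (U.isCover B (hsub hB))
  have hb : IsTopologicalBasis ((fun b => {p : Locale.PT L | p b}) '' ⋃ B ∈ 𝓑, F B) := by
    refine isTopologicalBasis_of_isOpen_of_nhds ?_ ?_
    · rintro _ ⟨b, -, rfl⟩
      exact Locale.PT.isOpen_ofPred b
    · rintro p _ hpa ⟨a, rfl⟩
      obtain ⟨x, A, hA, hxa, hpx⟩ := U.exists_of_point p hpa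
      obtain ⟨B, hB, hBA⟩ := hbasis A hA
      have hp : p (sSup (F B)) := by rw [hcov B hB]; simp
      obtain ⟨b, hbF, hpb⟩ := (p.sSup_iff _).1 hp
      refine ⟨_, mem_image_of_mem _ (mem_iUnion₂.2 ⟨B, hB, hbF⟩), hpb, fun q hqb => ?_⟩
      obtain ⟨c, hc, hbc⟩ := hBA b (hF B hB hbF)
      exact q.mono (hbc.trans ((coverStar_le_of_mem hc (p.mono hbc hpb) hpx).trans hxa)) hqb
  exact hb.secondCountableTopology
    ((hcount.biUnion fun B hB => (hfin B hB).countable).image _)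

theorem IsCompactFrame.nonempty_points [Nontrivial L] (h : IsCompactFrame L)
    (U : FrameUniformity L) : Nonempty (Locale.PT L) :=
  (h.exists_point U (a := ⊤) (b := ⊥) (by simp)).nonempty

theorem IsCompactFrame.exists_nat_bool_surjective_points [Nontrivial L] (h : IsCompactFrame L)
    (hL : IsMetrizableFrame L) :
    ∃ f : (ℕ → Bool) → Locale.PT L, Continuous f ∧ Function.Surjective f := by
  have := h.secondCountableTopology_points hL
  obtain ⟨U, -⟩ := hL
  have := h.nonempty_points U
  have := h.compactSpace_points U
  have := U.regularSpace_points
  let := metrizableSpaceMetric (Locale.PT L)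
  exact exists_nat_bool_continuous_surjective_of_compact _

/-- The frame homomorphism from `L` to the opens of its space of points. -/
def opensOfPoints (L : Type*) [Order.Frame L] : FrameHom L (Opens (Locale.PT L)) where
  toFun u := ⟨{x | x u}, Locale.PT.isOpen_ofPred u⟩
  map_inf' a b := by ext x; exact x.inf_iff a b
  map_top' := by ext x; simp
  map_sSup' S := by ext x; simp [Prop.exists_iff]

theorem IsCompactFrame.opensOfPoints_injective (h : IsCompactFrame L) (U : FrameUniformity L) :
    Function.Injective (opensOfPoints L) := by
  have key : ∀ a b : L, opensOfPoints L a = opensOfPoints L b → a ≤ b := by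
    intro a b hab
    by_contra hne
    obtain ⟨p, hpa, hpb⟩ := h.exists_point U hne
    exact hpb ((SetLike.ext_iff.1 hab p).1 hpa)
  exact fun a b hab => le_antisymm (key a b hab) (key b a hab.symm)

end Points

/-! ### The Cantor space as an image of `ℤ_2` -/

section Bits

/-- The binary digits of a `2`-adic integer. -/
noncomputable def PadicInt.bits (x : ℤ_[2]) (n : ℕ) : Bool :=
  (PadicInt.toZModPow (n + 1) x).val.testBit n

theorem PadicInt.continuous_bits : Continuous PadicInt.bits := by
  refine continuous_pi fun n => IsLocallyConstant.continuous ?_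
  refine (IsLocallyConstant.iff_eventually_eq _).2 fun x => ?_
  filter_upwards [Metric.ball_mem_nhds x (show (0 : ℝ) < 2 ^ (-(n + 1 : ℕ) : ℤ) by positivity)]
    with y hy
  have : PadicInt.toZModPow (n + 1) y = PadicInt.toZModPow (n + 1) x := by
    rw [← sub_eq_zero, ← map_sub, ← RingHom.mem_ker, PadicInt.ker_toZModPow,
      ← PadicInt.norm_le_pow_iff_mem_span_pow]
    rw [Metric.mem_ball, dist_eq_norm] at hy
    exact_mod_cast hy.le
  rw [PadicInt.bits, PadicInt.bits, this]

theorem PadicInt.bits_natCast (k n : ℕ) : PadicInt.bits (k : ℤ_[2]) n = k.testBit n := by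
  rw [PadicInt.bits, map_natCast, ZMod.val_natCast, Nat.testBit_mod_two_pow]
  simp

/-- The range is compact, hence closed, and it is dense because natural numbers realize every finite
digit prefix. -/
theorem PadicInt.bits_surjective : Function.Surjective PadicInt.bits := by
  intro f
  have hclosed : IsClosed (range PadicInt.bits) :=
    (isCompact_range PadicInt.continuous_bits).isClosed
  suffices Tendsto (fun N : ℕ => PadicInt.bits (Nat.ofBits fun i : Fin N => f i : ℕ)) atTop
      (𝓝 f) from hclosed.mem_of_tendsto this (Eventually.of_forall fun N => mem_range_self _)
  refine tendsto_pi_nhds.2 fun n => tendsto_const_nhds.congr' ?_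
  filter_upwards [eventually_gt_atTop n] with N hN
  rw [PadicInt.bits_natCast, Nat.testBit_ofBits_lt _ _ hN]

end Bits

theorem opensComap_injective_of_surjective {X Y : Type*} [TopologicalSpace X]
    [TopologicalSpace Y] (f : C(X, Y)) (hf : Function.Surjective f) :
    Function.Injective (Opens.comap f) := fun _ _ h =>
  SetLike.coe_injective (hf.preimage_injective (congrArg SetLike.coe h))

theorem theorem4 (L : Type*) [Order.Frame L] [Nontrivial L]
    (hcompact : IsCompactFrame L) (hmetrizable : IsMetrizableFrame L) :
    ∃ θ : FrameHom L (PadicIntFrame 2), Function.Injective θ := by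
  obtain ⟨f, hf, hfs⟩ := hcompact.exists_nat_bool_surjective_points hmetrizable
  obtain ⟨U, -⟩ := hmetrizable
  refine ⟨((opensToPadicIntFrame 2).comp
    (Opens.comap ⟨f ∘ PadicInt.bits, hf.comp PadicInt.continuous_bits⟩)).comp
      (opensOfPoints L), ?_⟩
  exact (opensToPadicIntFrame_injective.comp (opensComap_injective_of_surjective _
    (hfs.comp PadicInt.bits_surjective))).comp (hcompact.opensOfPoints_injective U)
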